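/- Setting. Let $T>0$, $s\ge 0$, and let $q\in L^\infty(0,1)$ be real-valued. Let $\mathcal L=-\frac{d^2}{dx^2}+q$ be the Sturm–Liouville operator in the complex space $L^2(0,1)$ with Dirichlet boundary conditions $y(0)=y(1)=0$, and let $\lambda_n$, $\phi_n$ ($n\ge 1$) be its eigenvalues and $L^2$-normalised eigenfunctions. Assume that all eigenvalues of $\mathcal L$ are positive. For $r\ge 0$ put $\mathcal L^{r}f=\sum_n\lambda_n^{r}\langle f,\phi_n\rangle\phi_n$ whenever the series converges in $L^2(0,1)$, let $W^s_{\mathcal L}(0,1)=\{f\in L^2(0,1):\mathcal L^{s/2}f\in L^2(0,1)\}$, and let $\|f\|_{W^s_{\mathcal L}}=\|\mathcal L^{s/2}f\|_{L^2}$. For non-negative $a,b\in L^\infty(0,1)$, $u_0\in W^s_{\mathcal L}(0,1)$ and $u_1\in L^2(0,1)$ consider the problem $$\partial_t^2u+\mathcal L^su+a(x)u+b(x)\partial_tu=0\ \text{ on }[0,T]\times(0,1),\qquad u(0,\cdot)=u_0,\quad \partial_tu(0,\cdot)=u_1,\qquad u(t,0)=u(t,1)=0. \tag{P}$$ A solution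 of (P) is a function $u\in C([0,T];W^s_{\mathcal L}(0,1))\cap C^1([0,T];L^2(0,1))$ with these initial values such that for every $w\in W^s_{\mathcal L}(0,1)$ and every $t\in[0,T]$ $$\frac{d}{dt}\langle \partial_tu(t),w\rangle+\langle\mathcal L^{s/2}u(t),\mathcal L^{s/2}w\rangle+\langle a\,u(t),w\rangle+\langle b\,\partial_tu(t),w\rangle=0,$$ where $\langle\cdot,\cdot\rangle$ is the inner product of $L^2(0,1)$; the boundary conditions are the Dirichlet conditions built into $\mathcal L$ and $W^s_{\mathcal L}$. A net $(f_\varepsilon)_{\varepsilon\in(0,1]}$ in a normed space $X$ is $X$-moderate if there are $N\in\mathbb N_0$ and $C>0$ with $\|f_\varepsilon\|_X\le C\varepsilon^{-N}$ for all $\varepsilon\in(0,1]$. Let $(a_\varepsilon)$, $(b_\varepsilon)$ be $L^\infty$-moderate nets of non-negative functions, $(u_{0,\varepsilon})$ a $W^s_{\mathcal L}$-moderate net and $(u_{1,\varepsilon})$ an $L^2$-moderate net. A net $(u_\varepsilon)_{\varepsilon\in(0,1]}$ is a very weak solution belonging to these regularising nets if, for every $\varepsilon\in(0,1]$, $u_\varepsilon$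 is a solution of (P) with $a_\varepsilon,b_\varepsilon,u_{0,\varepsilon},u_{1,\varepsilon}$ in place of $a,b,u_0,u_1$, and there are $N\in\mathbb N_0$ and $C>0$ with $$\sup_{t\in[0,T]}\big(\|u_\varepsilon(t)\|_{L^2}+\|\mathcal L^{s/2}u_\varepsilon(t)\|_{L^2}+\|\partial_tu_\varepsilon(t)\|_{L^2}\big)\le C\varepsilon^{-N}\quad\text{for all }\varepsilon\in(0,1].$$ Theorem (Consistency, case $s\ge 0$). Let $a,b\in L^\infty(0,1)$ be non-negative, $u_0\in W^s_{\mathcal L}(0,1)$, $u_1\in L^2(0,1)$, and let $u$ be a (classical) solution of (P). Then for any regularising nets as above with $$\|a_\varepsilon-a\|_{L^\infty}\to0,\quad \|b_\varepsilon-b\|_{L^\infty}\to0,\quad \|u_{0,\varepsilon}-u_0\|_{W^s_{\mathcal L}}\to0,\quad \|u_{1,\varepsilon}-u_1\|_{L^2}\to0\qquad(\varepsilon\to0),$$ and any very weak solution $(u_\varepsilon)_\varepsilon$ belonging to them, $$\sup_{t\in[0,T]}\|u_\varepsilon(t,\cdot)-u(t,\cdot)\|_{L^2(0,1)}\to0\qquad(\varepsilon\to0).$$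 -/

import Mathlib

open Set Filter Topology MeasureTheory
open scoped ENNReal

noncomputable section

namespace SturmLiouville

/-- Lebesgue measure on the interval `(0,1)`. -/
abbrev unitMeasure : Measure ℝ := volume.restrict (Ioo (0 : ℝ) 1)

/-- The complex Hilbert space `L²(0,1)`. -/
abbrev L2 : Type := Lp ℂ 2 unitMeasure

/-- The space `L^∞(0,1)` of real-valued functions. It acts on `L²(0,1)` by pointwise
multiplication, written `a • f`. -/
abbrev LInf : Type := Lp ℝ ∞ unitMeasure

/-- `-y'' + q y = g` on `(0,1)` with `y(0) = y(1) = 0`, where `f` is the class of `y` in `L²(0,1)`: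
`y` is differentiable on `[0,1]` and its derivative `v` is absolutely continuous, with
`v' = q f - g` almost everywhere. -/
def IsDirichletPair (q : LInf) (f g : L2) : Prop :=
  ∃ y v : ℝ → ℂ, f =ᵐ[unitMeasure] y ∧ y 0 = 0 ∧ y 1 = 0 ∧
    (∀ x ∈ Icc (0 : ℝ) 1, HasDerivWithinAt y (v x) (Icc 0 1) x) ∧
    ∀ x ∈ Icc (0 : ℝ) 1, v x = v 0 + ∫ t in Ioo 0 x, (q • f - g : L2) t

theorem integrableOn_L2 (h : L2) {x : ℝ} (hx : x ≤ 1) :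
    IntegrableOn (fun t => h t) (Ioo 0 x) := by
  have h1 : Integrable (fun t => h t) unitMeasure :=
    (Lp.memLp h).integrable (by norm_num)
  exact IntegrableOn.mono_set (t := Ioo (0 : ℝ) 1) h1 (Ioo_subset_Ioo_right hx)

theorem ae_Ioo {p : ℝ → Prop} (h : ∀ᵐ t ∂unitMeasure, p t) {x : ℝ} (hx : x ≤ 1) :
    ∀ᵐ t ∂(volume.restrict (Ioo (0 : ℝ) x)), p t :=
  ae_restrict_of_ae_restrict_of_subset (Ioo_subset_Ioo_right hx) h

theorem smul_mul_L2 (q : LInf) (c : ℂ) (f : L2) :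
    (q • (c • f : L2) : L2) = c • (q • f : L2) := by
  apply Lp.ext
  filter_upwards [Lp.coeFn_lpSMul (r := 2) q (c • f), Lp.coeFn_lpSMul (r := 2) q f,
    Lp.coeFn_smul c f, Lp.coeFn_smul c (q • f : L2)] with x h1 h2 h3 h4
  simp only [h1, h2, h3, h4, Pi.smul_apply, Pi.smul_apply']
  exact smul_comm _ _ _

/-- The graph of the Sturm-Liouville operator `L = -d²/dx² + q` in `L²(0,1)` with Dirichlet
boundary conditions: the pairs `(f, L f)` with `f` in the domain of `L`. -/
def graph (q : LInf) : Submodule ℂ (L2 × L2) where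
  carrier := {p | IsDirichletPair q p.1 p.2}
  zero_mem' := by
    refine ⟨0, 0, Lp.coeFn_zero _ _ _, rfl, rfl, fun x _ => hasDerivWithinAt_const x _ 0, ?_⟩
    intro x hx
    have h0 : (q • (0 : L2 × L2).1 - (0 : L2 × L2).2 : L2) = 0 := by simp
    rw [h0, integral_congr_ae (ae_Ioo (Lp.coeFn_zero ℂ 2 unitMeasure) hx.2)]
    simp
  add_mem' := by
    rintro ⟨f₁, g₁⟩ ⟨f₂, g₂⟩ ⟨y₁, v₁, hy₁, h₁0, h₁1, hd₁, hv₁⟩ ⟨y₂, v₂, hy₂, h₂0, h₂1, hd₂, hv₂⟩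
    refine ⟨y₁ + y₂, v₁ + v₂, (Lp.coeFn_add f₁ f₂).trans (hy₁.add hy₂), by simp [h₁0, h₂0],
      by simp [h₁1, h₂1], fun x hx => (hd₁ x hx).add (hd₂ x hx), ?_⟩
    intro x hx
    have h0 : (q • ((f₁, g₁) + (f₂, g₂) : L2 × L2).1 - ((f₁, g₁) + (f₂, g₂) : L2 × L2).2 : L2)
        = (q • f₁ - g₁ : L2) + (q • f₂ - g₂ : L2) := by
      simp only [Prod.mk_add_mk]
      rw [Lp.add_smul q f₁ f₂]
      abel
    rw [h0, integral_congr_ae (ae_Ioo (Lp.coeFn_add _ _) hx.2)]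
    simp only [Pi.add_apply]
    rw [integral_add (integrableOn_L2 _ hx.2) (integrableOn_L2 _ hx.2)]
    have e1 := hv₁ x hx
    have e2 := hv₂ x hx
    dsimp only at e1 e2
    rw [e1, e2]
    ring
  smul_mem' := by
    rintro c ⟨f, g⟩ ⟨y, v, hy, h0, h1, hd, hv⟩
    refine ⟨c • y, c • v, (Lp.coeFn_smul c f).trans (hy.const_smul c), by simp [h0],
      by simp [h1], fun x hx => (hd x hx).const_smul c, ?_⟩
    intro x hx
    have e0 : (q • (c • (f, g) : L2 × L2).1 - (c • (f, g) : L2 × L2).2 : L2)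
        = c • (q • f - g : L2) := by
      simp only [Prod.smul_mk, smul_sub]
      rw [smul_mul_L2]
    rw [e0, integral_congr_ae (ae_Ioo (Lp.coeFn_smul c _) hx.2)]
    simp only [Pi.smul_apply]
    rw [integral_smul, hv x hx, smul_add]

/-- The eigenspace `{f ∈ Dom L : L f = lam f}`. -/
def eigenspace (q : LInf) (lam : ℝ) : Submodule ℂ L2 :=
  (graph q).comap (LinearMap.prod LinearMap.id ((lam : ℂ) • LinearMap.id))

/-- `lam` is an eigenvalue of `L`. -/
def IsEigenvalue (q : LInf) (lam : ℝ) : Prop := eigenspace q lam ≠ ⊥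

/-- Orthogonal projection of `L²(0,1)` onto the eigenspace of `lam`, i.e. `f ↦ ⟨f, φ⟩ φ` if `lam` is
an eigenvalue with normalised eigenfunction `φ`, and `0` if `lam` is not an eigenvalue. (Eigenspaces
are finite dimensional, so taking the closure changes nothing.) -/
def spectralProj (q : LInf) (lam : ℝ) : L2 →L[ℂ] L2 :=
  (eigenspace q lam).topologicalClosure.starProjection

/-- `f` belongs to the domain of `L^r`: the eigenfunction expansion `∑ λₙ^r fₙ φₙ` converges in
`L²(0,1)`. The sum over all real `lam` has nonzero terms only at the eigenvalues. -/
def MemDomPow (q : LInf) (r : ℝ) (f : L2) : Prop :=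
  Summable fun lam : ℝ => (lam ^ r) • spectralProj q lam f

/-- The fractional power `L^r f = ∑ λₙ^r fₙ φₙ`. -/
def fracPow (q : LInf) (r : ℝ) (f : L2) : L2 :=
  ∑' lam : ℝ, (lam ^ r) • spectralProj q lam f

/-- `f ∈ W^s_L(0,1)`, for `s ≥ 0`: `f` is in `L²(0,1)`, with `L^{s/2} f ∈ L²(0,1)`. -/
def MemW (q : LInf) (s : ℝ) (f : L2) : Prop := MemDomPow q (s / 2) f

/-- The norm `‖f‖_{W^s_L} = ‖L^{s/2} f‖_{L²}`. -/
def normW (q : LInf) (s : ℝ) (f : L2) : ℝ := ‖fracPow q (s / 2) f‖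

/-- The time derivative `∂ₜ u` on `[0,T]` (one-sided at the end points) of an `L²`-valued
function. -/
def dt (T : ℝ) (u : ℝ → L2) : ℝ → L2 := derivWithin u (Icc 0 T)

/-- `u ∈ C([0,T]; W^s_L(0,1)) ∩ C¹([0,T]; L²(0,1))` solves
`∂ₜ²u + L^s u + a u + b ∂ₜu = 0` on `[0,T] × (0,1)`, `u(0) = u₀`, `∂ₜu(0) = u₁`, with
Dirichlet boundary conditions. The equation holds in the dual of `W^s_L(0,1)`, at every time; the
boundary conditions are those of the eigenfunctions that generate `W^s_L(0,1)`. -/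
structure IsSolution (q : LInf) (s T : ℝ) (a b : LInf) (u₀ u₁ : L2) (u : ℝ → L2) : Prop where
  memW : ∀ t ∈ Icc 0 T, MemW q s (u t)
  continuousOn_W : ∀ t ∈ Icc 0 T,
    Tendsto (fun τ => normW q s (u τ - u t)) (𝓝[Icc 0 T] t) (𝓝 0)
  contDiffOn : ContDiffOn ℝ 1 u (Icc 0 T)
  equation : ∀ w : L2, MemW q s w → ∀ t ∈ Icc 0 T,
    HasDerivWithinAt (fun τ => inner ℂ w (dt T u τ))
      (-(inner ℂ (fracPow q (s / 2) w) (fracPow q (s / 2) (u t))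
        + inner ℂ w (a • u t : L2) + inner ℂ w (b • dt T u t : L2)))
      (Icc 0 T) t
  initial : u 0 = u₀
  initial_dt : dt T u 0 = u₁

/-- A net of non-negative numbers (the norms of a net indexed by `ε ∈ (0,1]`) is moderate if it is
`O(ε^{-N})` on `(0,1]` for some `N`. -/
def IsModerate (n : ℝ → ℝ) : Prop :=
  ∃ N : ℕ, ∃ C : ℝ, ∀ ε ∈ Ioc (0 : ℝ) 1, n ε ≤ C * (ε⁻¹) ^ N

/-- `sup_{t ∈ [0,T]} (‖u_ε(t)‖_{L²} + ‖L^{s/2} u_ε(t)‖_{L²} + ‖∂ₜu_ε(t)‖_{L²}) = O(ε^{-N})` on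
`(0,1]` for some `N`. -/
def IsUniformlyModerate (q : LInf) (s T : ℝ) (u : ℝ → ℝ → L2) : Prop :=
  ∃ N : ℕ, ∃ C : ℝ, ∀ ε ∈ Ioc (0 : ℝ) 1, ∀ t ∈ Icc 0 T,
    ‖u ε t‖ + ‖fracPow q (s / 2) (u ε t)‖ + ‖dt T (u ε) t‖ ≤ C * (ε⁻¹) ^ N

/-- The net `(u_ε)`, `ε ∈ (0,1]`, is the very weak solution belonging to the regularising nets
`(a_ε)`, `(b_ε)` of the coefficients and `(u_{0,ε})`, `(u_{1,ε})` of the initial data: these nets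
are moderate, the coefficients are non-negative, `u_ε` solves the problem with coefficients
`a_ε, b_ε` and data `u_{0,ε}, u_{1,ε}`, and `(u_ε)` is uniformly `s`-moderate. -/
structure IsVeryWeakSolution (q : LInf) (s T : ℝ) (a b : ℝ → LInf) (u₀ u₁ : ℝ → L2)
    (u : ℝ → ℝ → L2) : Prop where
  nonneg_a : ∀ ε ∈ Ioc (0 : ℝ) 1, 0 ≤ a ε
  nonneg_b : ∀ ε ∈ Ioc (0 : ℝ) 1, 0 ≤ b ε
  memW : ∀ ε ∈ Ioc (0 : ℝ) 1, MemW q s (u₀ ε)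
  moderate_a : IsModerate fun ε => ‖a ε‖
  moderate_b : IsModerate fun ε => ‖b ε‖
  moderate_u₀ : IsModerate fun ε => normW q s (u₀ ε)
  moderate_u₁ : IsModerate fun ε => ‖u₁ ε‖
  isSolution : ∀ ε ∈ Ioc (0 : ℝ) 1, IsSolution q s T (a ε) (b ε) (u₀ ε) (u₁ ε) (u ε)
  moderate : IsUniformlyModerate q s T u

end SturmLiouville

end

/-!
Since `0` is not an eigenvalue, the compact self-adjoint Green operator of `-d²/dx²` can be
perturbed to a compact self-adjoint inverse of the Sturm-Liouville operator `L`, so the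
eigenprojections of `L` resolve the identity and its positive eigenvalues stay away from `0`. The
difference of two solutions solves an inhomogeneous wave equation, which the eigenprojections
decouple into forced oscillators with frequencies `λ^{s/2}`. Summing their energies gives
`‖∂ₜw‖² + ‖L^{s/2} w‖²`, whose growth is controlled by the forcing. The embedding of `W^s_L` into
`L²` absorbs the part of the forcing that is linear in the difference, the rest is small with the
perturbation of the coefficients, and Grönwall's inequality concludes.
-/

noncomputable section

namespace SturmLiouville

open ContinuousLinearMap (adjoint)
open InnerProductSpace (rankOne)

section HilbertSchmidt

variable {𝕜 E F : Type*} [RCLike 𝕜] [NormedAddCommGroup E] [InnerProductSpace 𝕜 E]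
  [NormedAddCommGroup F] [InnerProductSpace 𝕜 F]

theorem isCompactOperator_rankOne (x : F) (y : E) :
    IsCompactOperator (rankOne 𝕜 x y) := by
  rw [InnerProductSpace.rankOne_def']
  exact (isCompactOperator_of_locallyCompactSpace_dom (innerSL 𝕜 y)).clm_comp
    (ContinuousLinearMap.toSpanSingleton 𝕜 x)

theorem norm_le_sqrt_tsum_norm_sq {ι : Type*} (e : HilbertBasis ι 𝕜 E) (A : E →L[𝕜] F)
    (hA : Summable fun i => ‖A (e i)‖ ^ 2) : ‖A‖ ≤ √(∑' i, ‖A (e i)‖ ^ 2) := by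
  refine A.opNorm_le_bound (Real.sqrt_nonneg _) fun x => ?_
  have hAx : HasSum (fun i => inner 𝕜 (e i) x • A (e i)) (A x) := by
    simpa [e.repr_apply_apply] using (e.hasSum_repr x).mapL A
  refine le_of_tendsto hAx.norm (Eventually.of_forall fun s => ?_)
  calc ‖∑ i ∈ s, inner 𝕜 (e i) x • A (e i)‖
      ≤ ∑ i ∈ s, ‖inner 𝕜 (e i) x‖ * ‖A (e i)‖ :=
        norm_sum_le_of_le s fun i _ => (norm_smul _ _).le
    _ ≤ √(∑ i ∈ s, ‖inner 𝕜 (e i) x‖ ^ 2) * √(∑ i ∈ s, ‖A (e i)‖ ^ 2) :=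
        Real.sum_mul_le_sqrt_mul_sqrt _ _ _
    _ ≤ √(‖x‖ ^ 2) * √(∑' i, ‖A (e i)‖ ^ 2) := by
        gcongr
        · exact e.orthonormal.sum_inner_products_le x
        · exact hA.sum_le_tsum s fun i _ => sq_nonneg _
    _ = √(∑' i, ‖A (e i)‖ ^ 2) * ‖x‖ := by rw [Real.sqrt_sq (norm_nonneg x), mul_comm]

theorem isCompactOperator_of_summable_norm_sq [CompleteSpace F] {ι : Type*}
    (e : HilbertBasis ι 𝕜 E) (A : E →L[𝕜] F) (hA : Summable fun i => ‖A (e i)‖ ^ 2) :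
    IsCompactOperator A := by
  classical
  let B : Finset ι → E →L[𝕜] F := fun s => ∑ i ∈ s, rankOne 𝕜 (A (e i)) (e i)
  have hB_compact (s : Finset ι) : IsCompactOperator (B s) :=
    Submodule.sum_mem (compactOperator (RingHom.id 𝕜) E F) fun i _ =>
      isCompactOperator_rankOne (A (e i)) (e i)
  have hB_basis (s : Finset ι) (j : ι) :
      ‖(A - B s) (e j)‖ ^ 2 = {i | i ∉ s}.indicator (fun i => ‖A (e i)‖ ^ 2) j := by
    by_cases hj : j ∈ s <;>
      simp [B, hj, orthonormal_iff_ite.1 e.orthonormal, ite_smul]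
  have hB_norm (s : Finset ι) : ‖A - B s‖ ≤ √(∑' i : {i // i ∉ s}, ‖A (e i)‖ ^ 2) := by
    have h := norm_le_sqrt_tsum_norm_sq e (A - B s) (by
      simpa only [hB_basis] using hA.indicator {i | i ∉ s})
    simp only [hB_basis] at h
    rwa [← tsum_subtype] at h
  have htail : Tendsto (fun s : Finset ι => √(∑' i : {i // i ∉ s}, ‖A (e i)‖ ^ 2)) atTop (𝓝 0) := by
    simpa using (tendsto_tsum_compl_atTop_zero fun i => ‖A (e i)‖ ^ 2).sqrt
  refine isCompactOperator_of_tendsto (l := atTop) ?_ (Eventually.of_forall hB_compact)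
  exact tendsto_iff_norm_sub_tendsto_zero.2 <|
    squeeze_zero (fun _ => norm_nonneg _) (fun s => norm_sub_rev A (B s) ▸ hB_norm s) htail

theorem norm_sq_eq_integral_norm_sq {G α : Type*} [NormedAddCommGroup G] [MeasurableSpace α]
    {μ : Measure α} (f : Lp G 2 μ) : ‖f‖ ^ 2 = ∫ x, ‖f x‖ ^ 2 ∂μ := by
  have hint_nonneg : 0 ≤ ∫ x, ‖f x‖ ^ 2 ∂μ := integral_nonneg fun x => sq_nonneg _
  rw [Lp.norm_def, (Lp.memLp f).eLpNorm_eq_integral_rpow_norm two_ne_zero ENNReal.ofNat_ne_top,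
    ENNReal.toReal_ofReal (by positivity)]
  simp [← Real.sqrt_eq_rpow, ← one_div, Real.sq_sqrt hint_nonneg]

/-- Such an `A` is an integral operator with a Hilbert-Schmidt kernel: by Bessel's inequality in the
variable of integration, `∑ ‖A eᵢ‖² ≤ ∫ ‖k x‖² ∂μ` for every orthonormal family `e`. -/
theorem isCompactOperator_of_ae_eq_inner [CompleteSpace E] {α : Type*} [MeasurableSpace α]
    {μ : Measure α} [IsFiniteMeasure μ] (A : E →L[𝕜] Lp 𝕜 2 μ) (k : α → E) {C : ℝ}
    (hk : ∀ x, ‖k x‖ ≤ C) (hA : ∀ g, A g =ᵐ[μ] fun x => inner 𝕜 (k x) g) :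
    IsCompactOperator A := by
  obtain ⟨w, e, -⟩ := exists_hilbertBasis 𝕜 E
  refine isCompactOperator_of_summable_norm_sq e A
    (summable_of_sum_le (c := ∫ _, C ^ 2 ∂μ) (fun i => sq_nonneg _) fun s => ?_)
  have hint (g : Lp 𝕜 2 μ) : Integrable (fun x => ‖g x‖ ^ 2) μ :=
    (Lp.memLp g).integrable_norm_pow two_ne_zero
  have hbessel : ∀ᵐ x ∂μ, ∑ i ∈ s, ‖A (e i) x‖ ^ 2 ≤ C ^ 2 := by
    filter_upwards [(Finset.eventually_all s).2 fun i _ => hA (e i)] with x hx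
    calc ∑ i ∈ s, ‖A (e i) x‖ ^ 2 = ∑ i ∈ s, ‖inner 𝕜 (e i) (k x)‖ ^ 2 :=
          Finset.sum_congr rfl fun i hi => by rw [hx i hi, norm_inner_symm]
      _ ≤ ‖k x‖ ^ 2 := e.orthonormal.sum_inner_products_le _
      _ ≤ C ^ 2 := by gcongr; exact hk x
  calc ∑ i ∈ s, ‖A (e i)‖ ^ 2 = ∫ x, ∑ i ∈ s, ‖A (e i) x‖ ^ 2 ∂μ := by
        rw [integral_finsetSum _ fun i _ => hint _]
        simp only [norm_sq_eq_integral_norm_sq]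
    _ ≤ ∫ _, C ^ 2 ∂μ :=
        integral_mono_ae (integrable_finsetSum _ fun i _ => hint _) (integrable_const _) hbessel

end HilbertSchmidt

section Volterra

/-- The constant function `1` in `L²(0,1)`. -/
def one : L2 := Lp.const 2 unitMeasure 1

theorem coeFn_one : one =ᵐ[unitMeasure] fun _ => (1 : ℂ) := Lp.coeFn_const 2 unitMeasure 1

theorem inner_one (g : L2) : inner ℂ one g = ∫ t, g t ∂unitMeasure := by
  rw [one, ← indicatorConstLp_univ, L2.inner_indicatorConstLp_one, setIntegral_univ]

theorem inner_one_one : inner ℂ one one = (1 : ℂ) := by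
  rw [inner_one, integral_congr_ae coeFn_one]
  simp

/-- The primitive of `g ∈ L²(0,1)` that vanishes at `0`. -/
def primitive (g : L2) (x : ℝ) : ℂ := ∫ t in Ioo 0 x, g t

theorem primitive_zero (g : L2) : primitive g 0 = 0 := by simp [primitive]

theorem primitive_one (g : L2) : primitive g 1 = inner ℂ one g := by rw [inner_one, primitive]

theorem primitive_add (f g : L2) {x : ℝ} (hx : x ≤ 1) :
    primitive (f + g) x = primitive f x + primitive g x := by
  simp only [primitive, ← integral_add (integrableOn_L2 f hx) (integrableOn_L2 g hx)]
  exact integral_congr_ae (ae_Ioo (Lp.coeFn_add f g) hx)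

theorem primitive_smul (c : ℂ) (g : L2) {x : ℝ} (hx : x ≤ 1) :
    primitive (c • g) x = c • primitive g x := by
  simp only [primitive, ← integral_smul]
  exact integral_congr_ae (ae_Ioo (Lp.coeFn_smul c g) hx)

theorem primitive_eq_intervalIntegral (g : L2) {x : ℝ} (hx : 0 ≤ x) :
    primitive g x = ∫ t in (0 : ℝ)..x, g t := by
  rw [primitive, intervalIntegral.integral_of_le hx, integral_Ioc_eq_integral_Ioo]

theorem continuousOn_primitive (g : L2) : ContinuousOn (primitive g) (Icc 0 1) :=
  (intervalIntegral.continuousOn_primitive ((integrableOn_Icc_iff_integrableOn_Ioo).2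
    (integrableOn_L2 g le_rfl))).congr fun _ _ => integral_Ioc_eq_integral_Ioo.symm

/-- The characteristic function of `(0,x)` in `L²(0,1)`: integration over `(0,x)` is the inner
product with it. -/
def indicatorIoo (x : ℝ) : L2 :=
  indicatorConstLp 2 (measurableSet_Ioo (a := 0) (b := x)) (measure_ne_top unitMeasure _) 1

theorem inner_indicatorIoo (g : L2) {x : ℝ} (hx : x ≤ 1) :
    inner ℂ (indicatorIoo x) g = primitive g x := by
  rw [indicatorIoo, L2.inner_indicatorConstLp_one, primitive,
    Measure.restrict_restrict_of_subset (Ioo_subset_Ioo_right hx)]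

theorem norm_indicatorIoo_le (x : ℝ) : ‖indicatorIoo x‖ ≤ 1 := by
  rw [indicatorIoo, norm_indicatorConstLp two_ne_zero ENNReal.ofNat_ne_top, norm_one, one_mul]
  refine Real.rpow_le_one measureReal_nonneg ?_ (by norm_num)
  exact (measureReal_mono (subset_univ _)).trans (by simp [measureReal_def])

theorem norm_primitive_le (g : L2) {x : ℝ} (hx : x ≤ 1) : ‖primitive g x‖ ≤ ‖g‖ := by
  rw [← inner_indicatorIoo g hx]
  exact (norm_inner_le_norm _ _).trans
    (mul_le_of_le_one_left (norm_nonneg g) (norm_indicatorIoo_le x))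

theorem memLp_primitive (g : L2) : MemLp (primitive g) 2 unitMeasure := by
  refine MemLp.of_bound (((continuousOn_primitive g).mono
    Ioo_subset_Icc_self).aestronglyMeasurable measurableSet_Ioo) ‖g‖ ?_
  filter_upwards [ae_restrict_mem measurableSet_Ioo] with x hx
  exact norm_primitive_le g hx.2.le

/-- The Volterra operator: `primitive` as a bounded operator in `L²(0,1)`. -/
def volterra : L2 →L[ℂ] L2 :=
  LinearMap.mkContinuous
    { toFun := fun g => (memLp_primitive g).toLp
      map_add' := fun f g => by
        rw [← MemLp.toLp_add]
        refine MemLp.toLp_congr _ _ ?_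
        filter_upwards [ae_restrict_mem measurableSet_Ioo] with x hx
        exact primitive_add f g hx.2.le
      map_smul' := fun c g => by
        rw [RingHom.id_apply, ← MemLp.toLp_const_smul]
        refine MemLp.toLp_congr _ _ ?_
        filter_upwards [ae_restrict_mem measurableSet_Ioo] with x hx
        exact primitive_smul c g hx.2.le } 1 fun g => by
    have hbound : ∀ᵐ x ∂unitMeasure, ‖(memLp_primitive g).toLp (primitive g) x‖ ≤ ‖g‖ := by
      filter_upwards [(memLp_primitive g).coeFn_toLp, ae_restrict_mem measurableSet_Ioo]
        with x hgx hx
      exact hgx ▸ norm_primitive_le g hx.2.le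
    simpa [measureUnivNNReal] using Lp.norm_le_of_ae_bound (norm_nonneg g) hbound

theorem coeFn_volterra (g : L2) : volterra g =ᵐ[unitMeasure] primitive g :=
  (memLp_primitive g).coeFn_toLp

theorem isCompactOperator_volterra : IsCompactOperator volterra := by
  refine isCompactOperator_of_ae_eq_inner volterra indicatorIoo norm_indicatorIoo_le fun g => ?_
  filter_upwards [coeFn_volterra g, ae_restrict_mem measurableSet_Ioo] with x hgx hx
  rw [hgx, inner_indicatorIoo g hx.2.le]

theorem setIntegral_Iio_unitMeasure (g : L2) {x : ℝ} (hx : x ≤ 1) :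
    ∫ t in Iio x, g t ∂unitMeasure = primitive g x := by
  rw [primitive, Measure.restrict_restrict measurableSet_Iio, Iio_inter_Ioo, min_eq_left hx]

theorem setIntegral_Ioi_unitMeasure (g : L2) {x : ℝ} (hx : x ≤ 1) :
    ∫ t in Ioi x, g t ∂unitMeasure = inner ℂ one g - primitive g x := by
  have hg : Integrable g unitMeasure := (Lp.memLp g).integrable one_le_two
  rw [inner_one, ← setIntegral_Iio_unitMeasure g hx, ← integral_add_compl measurableSet_Iio hg,
    compl_Iio, setIntegral_congr_set Ioi_ae_eq_Ici, add_sub_cancel_left]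

theorem inner_volterra_right (f g : L2) :
    inner ℂ f (volterra g) = inner ℂ (inner ℂ one f • one - volterra f) g := by
  have hf : Integrable f unitMeasure := (Lp.memLp f).integrable one_le_two
  have hg : Integrable g unitMeasure := (Lp.memLp g).integrable one_le_two
  let H : ℝ → ℝ → ℂ := fun x t => {p : ℝ × ℝ | p.2 < p.1}.indicator
    (fun p => (starRingEnd ℂ) (f p.1) * g p.2) (x, t)
  have hH : Integrable (Function.uncurry H) (unitMeasure.prod unitMeasure) :=
    (((Complex.conjCLE : ℂ →L[ℝ] ℂ).integrable_comp hf).mul_prod hg).indicator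
      (measurableSet_lt measurable_snd measurable_fst)
  have hleft : inner ℂ f (volterra g) = ∫ x, ∫ t, H x t ∂unitMeasure ∂unitMeasure := by
    rw [L2.inner_def]
    refine integral_congr_ae ?_
    filter_upwards [coeFn_volterra g, ae_restrict_mem measurableSet_Ioo] with x hgx hx
    have hrow : H x = (Iio x).indicator fun t => (starRingEnd ℂ) (f x) * g t := rfl
    rw [hgx, hrow, integral_indicator measurableSet_Iio, integral_const_mul,
      setIntegral_Iio_unitMeasure g hx.2.le, RCLike.inner_apply, mul_comm]
  have hright : inner ℂ (inner ℂ one f • one - volterra f) g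
      = ∫ t, ∫ x, H x t ∂unitMeasure ∂unitMeasure := by
    rw [L2.inner_def]
    refine integral_congr_ae ?_
    filter_upwards [Lp.coeFn_sub (inner ℂ one f • one) (volterra f),
      Lp.coeFn_smul (inner ℂ one f) one, coeFn_one, coeFn_volterra f,
      ae_restrict_mem measurableSet_Ioo] with t hsub hsmul hone hft ht
    have hcol : (fun x => H x t) = (Ioi t).indicator fun x => (starRingEnd ℂ) (f x) * g t := rfl
    rw [hsub, Pi.sub_apply, hsmul, Pi.smul_apply, hone, hft, smul_eq_mul, mul_one, hcol,
      integral_indicator measurableSet_Ioi, integral_mul_const, integral_conj,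
      setIntegral_Ioi_unitMeasure f ht.2.le, RCLike.inner_apply, mul_comm]
  rw [hleft, hright, integral_integral_swap hH]

theorem adjoint_volterra : adjoint volterra = rankOne ℂ one one - volterra :=
  ((ContinuousLinearMap.eq_adjoint_iff _ _).2 fun f g => (inner_volterra_right f g).symm).symm

theorem eq_zero_of_volterra_eq_smul_one {g : L2} {c : ℂ} (h : volterra g = c • one) : g = 0 := by
  have hae : primitive g =ᵐ[unitMeasure] fun _ => c := by
    filter_upwards [coeFn_volterra g, Lp.coeFn_smul c one, coeFn_one] with x hgx hsmul hone
    rw [← hgx, h, hsmul, Pi.smul_apply, hone, smul_eq_mul, mul_one]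
  have hconst : EqOn (primitive g) (fun _ => c) (Ioo 0 1) :=
    Measure.eqOn_open_of_ae_eq hae isOpen_Ioo
      ((continuousOn_primitive g).mono Ioo_subset_Icc_self) continuousOn_const
  have hderiv := ((intervalIntegrable_iff_integrableOn_Ioo_of_le zero_le_one).2
    (integrableOn_L2 g le_rfl)).ae_hasDerivAt_integral
  apply Lp.ext
  filter_upwards [ae_restrict_of_ae hderiv, ae_restrict_mem measurableSet_Ioo,
    Lp.coeFn_zero ℂ 2 unitMeasure] with x hdx hx h0
  have hprim : (fun y => ∫ t in (0 : ℝ)..y, g t) =ᶠ[𝓝 x] fun _ => c := by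
    filter_upwards [isOpen_Ioo.mem_nhds hx] with y hy
    rw [← primitive_eq_intervalIntegral g hy.1.le, hconst hy]
  rw [h0]
  exact (hdx (by rw [uIcc_of_le zero_le_one]; exact Ioo_subset_Icc_self hx) 0 (by simp)).unique
    ((hasDerivAt_const x c).congr_of_eventuallyEq hprim)

end Volterra

section Green

theorem hasDerivWithinAt_integral_of_continuousOn {E : Type*} [NormedAddCommGroup E]
    [NormedSpace ℝ E] [CompleteSpace E] {a b t : ℝ} {f : ℝ → E} (hf : ContinuousOn f (Icc a b))
    (ht : t ∈ Icc a b) :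
    HasDerivWithinAt (fun r => ∫ τ in a..r, f τ) (f t) (Icc a b) t := by
  have : Fact (t ∈ Icc a b) := ⟨ht⟩
  refine intervalIntegral.integral_hasDerivWithinAt_right ?_
    (hf.stronglyMeasurableAtFilter_nhdsWithin measurableSet_Icc t) (hf t ht)
  exact (hf.mono (Icc_subset_Icc_right ht.2)).intervalIntegrable_of_Icc ht.1

theorem primitive_eq_intervalIntegral_of_ae_eq {g : L2} {v : ℝ → ℂ} (hg : g =ᵐ[unitMeasure] v)
    {x : ℝ} (hx : x ∈ Icc (0 : ℝ) 1) : primitive g x = ∫ t in (0 : ℝ)..x, v t := by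
  rw [intervalIntegral.integral_of_le hx.1, integral_Ioc_eq_integral_Ioo, primitive]
  exact integral_congr_ae (ae_Ioo hg hx.2)

theorem hasDerivWithinAt_primitive {g : L2} {v : ℝ → ℂ} (hv : ContinuousOn v (Icc 0 1))
    (hg : g =ᵐ[unitMeasure] v) {x : ℝ} (hx : x ∈ Icc (0 : ℝ) 1) :
    HasDerivWithinAt (primitive g) (v x) (Icc 0 1) x :=
  (hasDerivWithinAt_integral_of_continuousOn hv hx).congr
    (fun _ hy => primitive_eq_intervalIntegral_of_ae_eq hg hy)
    (primitive_eq_intervalIntegral_of_ae_eq hg hx)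

theorem eqOn_primitive_of_hasDerivWithinAt {g : L2} {y v : ℝ → ℂ} (hv : ContinuousOn v (Icc 0 1))
    (hg : g =ᵐ[unitMeasure] v) (hy0 : y 0 = 0)
    (hy : ∀ x ∈ Icc (0 : ℝ) 1, HasDerivWithinAt y (v x) (Icc 0 1) x) :
    EqOn y (primitive g) (Icc 0 1) := by
  intro x hx
  have hsub : Icc 0 x ⊆ Icc (0 : ℝ) 1 := Icc_subset_Icc_right hx.2
  rw [primitive_eq_intervalIntegral_of_ae_eq hg hx,
    intervalIntegral.integral_eq_sub_of_hasDerivAt_of_le hx.1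
      (fun t ht => (hy t (hsub ht)).continuousWithinAt.mono hsub)
      (fun t ht => (hy t (hsub (Ioo_subset_Icc_self ht))).hasDerivAt
        (Icc_mem_nhds ht.1 (ht.2.trans_le hx.2)))
      ((hv.mono hsub).intervalIntegrable_of_Icc hx.1), hy0, sub_zero]

theorem coeFn_smul_one_add_volterra (c : ℂ) (h : L2) :
    (c • one + volterra h : L2) =ᵐ[unitMeasure] fun x => c + primitive h x := by
  filter_upwards [Lp.coeFn_add (c • one) (volterra h), Lp.coeFn_smul c one, coeFn_one,
    coeFn_volterra h] with x hadd hsmul hone hh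
  rw [hadd, Pi.add_apply, hsmul, Pi.smul_apply, hone, hh, smul_eq_mul, mul_one]

theorem isDirichletPair_iff_exists (q : LInf) (f g : L2) :
    IsDirichletPair q f g ↔ ∃ c : ℂ, f = volterra (c • one + volterra (q • f - g)) ∧
      inner ℂ one (c • one + volterra (q • f - g)) = (0 : ℂ) := by
  have hcont (c : ℂ) : ContinuousOn (fun x => c + primitive (q • f - g) x) (Icc 0 1) :=
    continuousOn_const.add (continuousOn_primitive _)
  constructor
  · rintro ⟨y, v, hfy, hy0, hy1, hy, hv⟩
    have hyw : EqOn y (primitive (v 0 • one + volterra (q • f - g))) (Icc 0 1) :=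
      eqOn_primitive_of_hasDerivWithinAt (hcont (v 0)) (coeFn_smul_one_add_volterra _ _) hy0
        fun x hx => (hy x hx).congr_deriv (hv x hx)
    refine ⟨v 0, Lp.ext ?_, ?_⟩
    · filter_upwards [hfy, coeFn_volterra (v 0 • one + volterra (q • f - g)),
        ae_restrict_mem measurableSet_Ioo] with x hfx hvx hx
      rw [hfx, hvx, hyw (Ioo_subset_Icc_self hx)]
    · rw [← primitive_one, ← hyw (right_mem_Icc.2 zero_le_one), hy1]
  · rintro ⟨c, hf, horth⟩
    refine ⟨primitive (c • one + volterra (q • f - g)), fun x => c + primitive (q • f - g) x, ?_,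
      primitive_zero _, by rw [primitive_one, horth], fun x hx =>
        hasDerivWithinAt_primitive (hcont c) (coeFn_smul_one_add_volterra _ _) hx, fun x _ => ?_⟩
    · nth_rewrite 1 [hf]
      exact coeFn_volterra _
    · simp only [primitive_zero, add_zero]
      rfl

/-- The inverse of `-d²/dx²` with Dirichlet boundary conditions. The factor
`id - rankOne ℂ one one`, the orthogonal projection onto the functions of mean zero, enforces the
boundary condition at `1`. -/
def green : L2 →L[ℂ] L2 :=
  volterra ∘L (ContinuousLinearMap.id ℂ L2 - rankOne ℂ one one) ∘L adjoint volterra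

theorem green_apply (g : L2) :
    green g = volterra ((inner ℂ one (volterra g) : ℂ) • one - volterra g) := by
  have hproj : (ContinuousLinearMap.id ℂ L2 - rankOne ℂ one one) (adjoint volterra g)
      = (inner ℂ one (volterra g) : ℂ) • one - volterra g := by
    rw [adjoint_volterra, sub_apply, ContinuousLinearMap.id_apply, sub_apply,
      InnerProductSpace.rankOne_apply, InnerProductSpace.rankOne_apply, inner_sub_right,
      inner_smul_right, inner_one_one]
    module
  rw [green, ContinuousLinearMap.comp_apply, ContinuousLinearMap.comp_apply, hproj]

theorem isCompactOperator_green : IsCompactOperator green :=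
  isCompactOperator_volterra.comp_clm _

theorem isSelfAdjoint_green : IsSelfAdjoint green :=
  IsSelfAdjoint.conj_adjoint ((IsSelfAdjoint.one _).sub (by
    simp [ContinuousLinearMap.isSelfAdjoint_iff'])) volterra

theorem injective_green : Function.Injective green :=
  (injective_iff_map_eq_zero green).2 fun g hg => by
    rw [green_apply] at hg
    have hmean := eq_zero_of_volterra_eq_smul_one (hg.trans (zero_smul ℂ one).symm)
    exact eq_zero_of_volterra_eq_smul_one (sub_eq_zero.1 hmean).symm

theorem mem_graph_iff (q : LInf) (f g : L2) :
    (f, g) ∈ graph q ↔ f + green (q • f) = green g := by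
  have horth (c : ℂ) (h : L2) :
      inner ℂ one (c • one + volterra h) = (0 : ℂ) ↔ c = -inner ℂ one (volterra h) := by
    rw [inner_add_right, inner_smul_right, inner_one_one, mul_one, add_eq_zero_iff_eq_neg]
  have hgreen : volterra (-inner ℂ one (volterra (q • f - g)) • one + volterra (q • f - g))
      = green g - green (q • f) := by
    rw [← map_sub, green_apply, ← neg_sub (q • f) g]
    simp only [map_neg, inner_neg_right, sub_neg_eq_add]
  change IsDirichletPair q f g ↔ _
  simp only [isDirichletPair_iff_exists, horth, exists_eq_right, hgreen, eq_sub_iff_add_eq]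

end Green

section Perturbation

theorem isUnit_one_add_of_isCompactOperator {𝕜 X : Type*} [NontriviallyNormedField 𝕜]
    [NormedAddCommGroup X] [NormedSpace 𝕜 X] [CompleteSpace X] {K : X →L[𝕜] X}
    (hK : IsCompactOperator K) (hker : ∀ x, x + K x = 0 → x = 0) : IsUnit (1 + K) := by
  have hnot : ¬ Module.End.HasEigenvalue (K : Module.End 𝕜 X) (-1) := by
    rintro h
    obtain ⟨x, hx⟩ := h.exists_hasEigenvector
    refine hx.2 (hker x ?_)
    rw [show K x = (-1 : 𝕜) • x from hx.apply_eq_smul]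
    module
  have hmem := (hK.hasEigenvalue_or_mem_resolventSet (neg_ne_zero.2 one_ne_zero)).resolve_left hnot
  rw [spectrum.mem_resolventSet_iff, map_neg, map_one, ← neg_add', IsUnit.neg_iff] at hmem
  exact hmem

theorem exists_isCompactOperator_isSelfAdjoint_solution {𝕜 H : Type*} [RCLike 𝕜]
    [NormedAddCommGroup H] [InnerProductSpace 𝕜 H] [CompleteSpace H] {G Q : H →L[𝕜] H}
    (hG : IsCompactOperator G) (hGsa : IsSelfAdjoint G) (hQsa : IsSelfAdjoint Q)
    (hker : ∀ f, f + G (Q f) = 0 → f = 0) :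
    ∃ R : H →L[𝕜] H, IsCompactOperator R ∧ IsSelfAdjoint R ∧
      ∀ f g, f + G (Q f) = G g ↔ f = R g := by
  obtain ⟨U, hU⟩ : IsUnit (1 + G * Q) :=
    isUnit_one_add_of_isCompactOperator (hG.comp_clm Q) hker
  have hcomm : SemiconjBy G (star U : (H →L[𝕜] H)ˣ) U := by
    simp only [SemiconjBy, Units.coe_star, hU, star_add, star_one, star_mul, hGsa.star_eq,
      hQsa.star_eq]
    noncomm_ring
  have hsa : IsSelfAdjoint ((U⁻¹ : (H →L[𝕜] H)ˣ) * G) := by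
    rw [IsSelfAdjoint, star_mul, hGsa.star_eq, ← Units.coe_star_inv]
    exact hcomm.units_inv_right
  refine ⟨U⁻¹ * G, hG.clm_comp _, hsa, fun f g => ?_⟩
  have hUf : U.1 f = f + G (Q f) := by rw [hU]; rfl
  rw [← hUf]
  constructor
  · intro h
    rw [mul_apply_eq_comp, ← h, ← mul_apply_eq_comp, U.inv_mul, one_apply_eq_self]
  · rintro rfl
    rw [← mul_apply_eq_comp, U.mul_inv_cancel_left]

end Perturbation

section ResolutionOfIdentity

variable {ι 𝕜 H : Type*} [RCLike 𝕜] [NormedAddCommGroup H] [InnerProductSpace 𝕜 H]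

/-- The operators `P i` are orthogonal projections with pairwise orthogonal ranges that sum strongly
to the identity: an orthogonal decomposition of `H`, allowing vanishing summands. That each `P i`
is idempotent follows from the fields. -/
structure IsResolutionOfIdentity (P : ι → H →L[𝕜] H) : Prop where
  isSymmetric : ∀ i, (P i).IsSymmetric
  apply_apply_of_ne : ∀ ⦃i j⦄, i ≠ j → ∀ x, P i (P j x) = 0
  hasSum : ∀ x, HasSum (fun i => P i x) x

theorem isResolutionOfIdentity_starProjection {V : ι → Submodule 𝕜 H}
    [∀ i, (V i).HasOrthogonalProjection] [CompleteSpace H]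
    (hV : IsHilbertSum 𝕜 (fun i => V i) fun i => (V i).subtypeₗᵢ) :
    IsResolutionOfIdentity fun i => (V i).starProjection := by
  classical
  have hortho {i j : ι} (hij : i ≠ j) {x : H} (hx : x ∈ V j) : (V i).starProjection x = 0 :=
    (Submodule.starProjection_apply_eq_zero_iff _).2 fun y hy =>
      (hV.OrthogonalFamily.isOrtho hij).inner_eq hy hx
  refine ⟨fun i => (Submodule.isSymmetricProjection_starProjection _).isSymmetric,
    fun i j hij x => hortho hij (Submodule.starProjection_apply_mem _ _), fun x => ?_⟩
  obtain ⟨w, rfl⟩ := hV.surjective_isometry x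
  have hsum : HasSum (fun i => (w i : H)) (hV.OrthogonalFamily.linearIsometry w) :=
    hV.OrthogonalFamily.hasSum_linearIsometry w
  have hcoord (i : ι) : (V i).starProjection (hV.OrthogonalFamily.linearIsometry w) = w i := by
    refine (hsum.mapL (V i).starProjection).unique ?_
    convert! hasSum_single i fun j hji => hortho (Ne.symm hji) (w j).2
    exact (Submodule.starProjection_eq_self_iff.2 (w i).2).symm
  simpa only [hcoord] using hsum

namespace IsResolutionOfIdentity

variable {P : ι → H →L[𝕜] H} (hP : IsResolutionOfIdentity P)
include hP

theorem comp_equiv {κ : Type*} (e : κ ≃ ι) : IsResolutionOfIdentity (P ∘ e) :=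
  ⟨fun k => hP.isSymmetric (e k), fun _ _ hkl => hP.apply_apply_of_ne (e.injective.ne hkl),
    fun x => e.hasSum_iff.2 (hP.hasSum x)⟩

theorem apply_apply_self (i : ι) (x : H) : P i (P i x) = P i x :=
  (hasSum_single i fun _ hj => hP.apply_apply_of_ne hj x).unique (hP.hasSum (P i x))

theorem re_inner_apply_self (i : ι) (x : H) : RCLike.re (inner 𝕜 x (P i x)) = ‖P i x‖ ^ 2 := by
  have hsymm : inner 𝕜 (P i x) (P i x) = inner 𝕜 x (P i (P i x)) := hP.isSymmetric i x (P i x)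
  rw [← inner_self_eq_norm_sq (𝕜 := 𝕜), hsymm, hP.apply_apply_self]

theorem hasSum_norm_sq (x : H) : HasSum (fun i => ‖P i x‖ ^ 2) (‖x‖ ^ 2) := by
  have h := ((hP.hasSum x).mapL (innerSL 𝕜 x)).mapL RCLike.reCLM
  simpa only [innerSL_apply_apply, RCLike.reCLM_apply, hP.re_inner_apply_self,
    inner_self_eq_norm_sq] using h

variable [NormedSpace ℝ H] {c : ι → ℝ} {x y : H}

theorem hasSum_smul_apply_apply (c : ι → ℝ) (i : ι) (x : H) :
    HasSum (fun j => c j • P j (P i x)) (c i • P i x) := by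
  have h : HasSum (fun j => c j • P j (P i x)) (c i • P i (P i x)) :=
    hasSum_single i fun j hji => by rw [hP.apply_apply_of_ne hji, smul_zero]
  rwa [hP.apply_apply_self] at h

theorem apply_of_hasSum (h : HasSum (fun i => c i • P i x) y) (i : ι) : P i y = c i • P i x := by
  have hsmul (j : ι) : P i (c j • P j x) = c j • P i (P j x) :=
    map_real_smul (P i) (P i).continuous _ _
  have hsingle : HasSum (fun j => P i (c j • P j x)) (P i (c i • P i x)) :=
    hasSum_single i fun j hji => by rw [hsmul, hP.apply_apply_of_ne hji.symm, smul_zero]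
  rw [(h.mapL (P i)).unique hsingle, hsmul, hP.apply_apply_self]

theorem hasSum_norm_sq_of_hasSum (h : HasSum (fun i => c i • P i x) y) :
    HasSum (fun i => c i ^ 2 * ‖P i x‖ ^ 2) (‖y‖ ^ 2) := by
  simpa only [hP.apply_of_hasSum h, norm_smul, mul_pow, Real.norm_eq_abs, sq_abs]
    using hP.hasSum_norm_sq y

theorem mul_norm_le_of_hasSum {k : ℝ} (hk : 0 ≤ k) (hkc : ∀ i, P i ≠ 0 → k ≤ c i)
    (h : HasSum (fun i => c i • P i x) y) : k * ‖x‖ ≤ ‖y‖ := by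
  refine le_of_sq_le_sq ?_ (norm_nonneg y)
  rw [mul_pow]
  refine hasSum_le (fun i => ?_) ((hP.hasSum_norm_sq x).mul_left (k ^ 2))
    (hP.hasSum_norm_sq_of_hasSum h)
  by_cases hi : P i = 0
  · simp [hi]
  · gcongr
    exact hkc i hi

end IsResolutionOfIdentity

theorem isHilbertSum_real_eigenspace [CompleteSpace H] {R : H →L[𝕜] H} (hR : IsCompactOperator R)
    (hsa : IsSelfAdjoint R) :
    IsHilbertSum 𝕜 (fun r : ℝ => Module.End.eigenspace (R : Module.End 𝕜 H) (r : 𝕜))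
      fun r => (Module.End.eigenspace (R : Module.End 𝕜 H) (r : 𝕜)).subtypeₗᵢ := by
  have hsymm : (R : Module.End 𝕜 H).IsSymmetric := hsa.isSymmetric
  have : ∀ r : ℝ, CompleteSpace (Module.End.eigenspace (R : Module.End 𝕜 H) (r : 𝕜)) :=
    fun r => (R.isClosed_eigenspace _).completeSpace_coe
  refine IsHilbertSum.mkInternal _
    (hsymm.orthogonalFamily_eigenspaces.comp RCLike.ofReal_injective) ?_
  have hle : ⨆ μ : 𝕜, Module.End.eigenspace (R : Module.End 𝕜 H) μ
      ≤ ⨆ r : ℝ, Module.End.eigenspace (R : Module.End 𝕜 H) (r : 𝕜) := by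
    refine iSup_le fun μ => ?_
    by_cases hμ : Module.End.HasEigenvalue (R : Module.End 𝕜 H) μ
    · obtain ⟨r, rfl⟩ := RCLike.conj_eq_iff_real.1 (hsymm.conj_eigenvalue_eq_self hμ)
      exact le_iSup (fun r : ℝ => Module.End.eigenspace (R : Module.End 𝕜 H) (r : 𝕜)) r
    · rw [Module.End.hasEigenvalue_iff, not_not] at hμ
      exact hμ ▸ bot_le
  rw [(Submodule.topologicalClosure_eq_top_iff).2 (eq_bot_iff.2 ?_)]
  rw [← ContinuousLinearMap.orthogonalComplement_iSup_eigenspaces_eq_bot hR hsymm]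
  exact Submodule.orthogonal_le hle

end ResolutionOfIdentity

section Inverse

/-- Multiplication by a bounded function, as an operator on `L²(0,1)`. -/
def mulOp (q : LInf) : L2 →L[ℂ] L2 :=
  LinearMap.mkContinuous
    { toFun := fun f => q • f
      map_add' := Lp.add_smul q
      map_smul' := smul_mul_L2 q } ‖q‖ (Lp.norm_smul_le q)

theorem isSelfAdjoint_mulOp (q : LInf) : IsSelfAdjoint (mulOp q) := by
  refine ContinuousLinearMap.isSelfAdjoint_iff_isSymmetric.2 fun f g => ?_
  change inner ℂ (q • f) g = inner ℂ f (q • g)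
  rw [L2.inner_def, L2.inner_def]
  refine integral_congr_ae ?_
  filter_upwards [Lp.coeFn_lpSMul (r := 2) q f, Lp.coeFn_lpSMul (r := 2) q g] with x hf hg
  rw [hf, hg, Pi.smul_apply', Pi.smul_apply', inner_smul_left_eq_smul, inner_smul_right_eq_smul]

/-- `R` is a bounded inverse of the Sturm-Liouville operator with potential `q`. -/
def IsInverse (q : LInf) (R : L2 →L[ℂ] L2) : Prop :=
  ∀ f g, (f, g) ∈ graph q ↔ f = R g

theorem exists_isInverse {q : LInf} (h0 : ¬ IsEigenvalue q 0) :
    ∃ R, IsInverse q R ∧ IsCompactOperator R ∧ IsSelfAdjoint R := by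
  have hker (f : L2) (hf : f + green (mulOp q f) = 0) : f = 0 := by
    have hmem : f ∈ eigenspace q 0 := by
      change (f, ((0 : ℝ) : ℂ) • f) ∈ graph q
      rw [mem_graph_iff, Complex.ofReal_zero, zero_smul, map_zero]
      exact hf
    rwa [not_not.1 h0, Submodule.mem_bot] at hmem
  obtain ⟨R, hcompact, hsa, hR⟩ := exists_isCompactOperator_isSelfAdjoint_solution
    isCompactOperator_green isSelfAdjoint_green (isSelfAdjoint_mulOp q) hker
  exact ⟨R, fun f g => (mem_graph_iff q f g).trans (hR f g), hcompact, hsa⟩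

namespace IsInverse

variable {q : LInf} {R : L2 →L[ℂ] L2} (hR : IsInverse q R)
include hR

theorem injective : Function.Injective R :=
  (injective_iff_map_eq_zero R).2 fun g hg => by
    have hmem := (mem_graph_iff q 0 g).1 ((hR 0 g).2 hg.symm)
    rwa [Lp.smul_zero, map_zero, add_zero, eq_comm, map_eq_zero_iff green injective_green] at hmem

theorem eigenspace_eq (lam : ℝ) :
    eigenspace q lam = Module.End.eigenspace (R : Module.End ℂ L2) ((lam⁻¹ : ℝ) : ℂ) := by
  ext f
  rw [Module.End.mem_eigenspace_iff]
  change (f, (lam : ℂ) • f) ∈ graph q ↔ R f = _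
  rw [hR, map_smul]
  rcases eq_or_ne lam 0 with rfl | hlam
  · simp [map_eq_zero_iff R hR.injective]
  · rw [Complex.ofReal_inv, eq_inv_smul_iff₀ (Complex.ofReal_ne_zero.2 hlam), eq_comm]

theorem inv_norm_add_one_le {lam : ℝ} (hlam : IsEigenvalue q lam) (hpos : 0 < lam) :
    (‖R‖ + 1)⁻¹ ≤ lam := by
  obtain ⟨f, hf, hf0⟩ := Submodule.exists_mem_ne_zero_of_ne_bot hlam
  have hbound : ‖f‖ ≤ ‖R‖ * (lam * ‖f‖) := by
    calc ‖f‖ = ‖R ((lam : ℂ) • f)‖ := congrArg norm ((hR _ _).1 hf)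
      _ ≤ ‖R‖ * ‖(lam : ℂ) • f‖ := R.le_opNorm _
      _ = ‖R‖ * (lam * ‖f‖) := by rw [norm_smul, Complex.norm_of_nonneg hpos.le]
  rw [inv_le_iff_one_le_mul₀ (by positivity)]
  have hnorm := norm_pos_iff.2 hf0
  have : 1 ≤ lam * ‖R‖ := by nlinarith
  nlinarith

theorem isResolutionOfIdentity_spectralProj (hcompact : IsCompactOperator R)
    (hsa : IsSelfAdjoint R) : IsResolutionOfIdentity (spectralProj q) := by
  have : ∀ r : ℝ, CompleteSpace (Module.End.eigenspace (R : Module.End ℂ L2) (r : ℂ)) :=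
    fun r => (R.isClosed_eigenspace _).completeSpace_coe
  convert! (isResolutionOfIdentity_starProjection
    (isHilbertSum_real_eigenspace hcompact hsa)).comp_equiv (inv_involutive.toPerm) using 1
  ext1 lam
  have hV : (eigenspace q lam).topologicalClosure
      = Module.End.eigenspace (R : Module.End ℂ L2) ((lam⁻¹ : ℝ) : ℂ) := by
    rw [hR.eigenspace_eq, (R.isClosed_eigenspace _).submodule_topologicalClosure_eq]
  exact Submodule.starProjection_inj.2 hV

end IsInverse

theorem isResolutionOfIdentity_spectralProj {q : LInf} (h0 : ¬ IsEigenvalue q 0) :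
    IsResolutionOfIdentity (spectralProj q) := by
  obtain ⟨R, hR, hcompact, hsa⟩ := exists_isInverse h0
  exact hR.isResolutionOfIdentity_spectralProj hcompact hsa

theorem isEigenvalue_of_spectralProj_ne_zero {q : LInf} {lam : ℝ} (h : spectralProj q lam ≠ 0) :
    IsEigenvalue q lam := by
  rintro hbot
  refine h (ContinuousLinearMap.ext fun f => ?_)
  simp [spectralProj, hbot]

theorem exists_pos_forall_isEigenvalue_le {q : LInf} (hq : ∀ lam, IsEigenvalue q lam → 0 < lam) :
    ∃ m > 0, ∀ lam, IsEigenvalue q lam → m ≤ lam := by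
  obtain ⟨R, hR, -, -⟩ := exists_isInverse fun h => (hq 0 h).false
  exact ⟨(‖R‖ + 1)⁻¹, by positivity, fun lam hlam => hR.inv_norm_add_one_le hlam (hq lam hlam)⟩

end Inverse

section Energy

theorem le_gronwallBound_of_le_integral {E : ℝ → ℝ} {T E₀ K d : ℝ} (hK : 0 ≤ K)
    (hE : ContinuousOn E (Icc 0 T))
    (hle : ∀ t ∈ Icc 0 T, E t ≤ E₀ + ∫ τ in (0 : ℝ)..t, (K * E τ + d)) {t : ℝ}
    (ht : t ∈ Icc 0 T) : E t ≤ gronwallBound E₀ K d t := by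
  let F (r : ℝ) : ℝ := E₀ + ∫ τ in (0 : ℝ)..r, (K * E τ + d)
  have hF (r : ℝ) (hr : r ∈ Icc 0 T) : HasDerivWithinAt F (K * E r + d) (Icc 0 T) r :=
    (hasDerivWithinAt_integral_of_continuousOn (by fun_prop) hr).const_add E₀
  have hbound (r : ℝ) (hr : r ∈ Icc 0 T) : F r ≤ gronwallBound E₀ K d (r - 0) := by
    refine le_gronwallBound_of_liminf_deriv_right_le (f' := fun r => K * E r + d)
      (fun r hr => (hF r hr).continuousWithinAt) (fun r hr ρ hρ => ?_) (by simp [F])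
      (fun r hr => ?_) r hr
    · exact ((hF r (Ico_subset_Icc_self hr)).mono_of_mem_nhdsWithin
        (Icc_mem_nhdsGE_of_mem hr)).liminf_right_slope_le hρ
    · have := hle r (Ico_subset_Icc_self hr)
      gcongr
  simpa only [sub_zero] using (hle t ht).trans (hbound t ht)

variable {ι 𝕜 H : Type*} [RCLike 𝕜] [NormedAddCommGroup H] [InnerProductSpace 𝕜 H]
  [NormedSpace ℝ H]

theorem hasDerivWithinAt_of_inner [CompleteSpace H] {a b : ℝ} {v h : ℝ → H}
    (hh : ContinuousOn h (Icc a b))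
    (hweak : ∀ x : H, ∀ t ∈ Icc a b,
      HasDerivWithinAt (fun τ => inner 𝕜 x (v τ)) (inner 𝕜 x (h t)) (Icc a b) t)
    {t : ℝ} (ht : t ∈ Icc a b) : HasDerivWithinAt v (h t) (Icc a b) t := by
  have hJ (r : ℝ) (hr : r ∈ Icc a b) := hasDerivWithinAt_integral_of_continuousOn hh hr
  have hconst (r : ℝ) (hr : r ∈ Icc a b) : v r - ∫ τ in a..r, h τ = v a := by
    refine ext_inner_left 𝕜 fun x => ?_
    have hderiv (r : ℝ) (hr : r ∈ Icc a b) :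
        HasDerivWithinAt (fun ρ => inner 𝕜 x (v ρ - ∫ τ in a..ρ, h τ)) 0 (Icc a b) r := by
      have hJx := (hasDerivWithinAt_const r (Icc a b) x).inner 𝕜 (hJ r hr)
      simpa [inner_sub_right] using (hweak x r hr).fun_sub hJx
    have := constant_of_has_deriv_right_zero (fun r hr => (hderiv r hr).continuousWithinAt)
      (fun r hr => (hderiv r (Ico_subset_Icc_self hr)).mono_of_mem_nhdsWithin
        (Icc_mem_nhdsGE_of_mem hr)) r hr
    simpa using this
  refine ((hJ t ht).const_add (v a)).congr_of_mem (fun r hr => ?_) ht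
  rw [← hconst r hr, sub_add_cancel]

theorem hasDerivWithinAt_norm_sq (𝕜 : Type*) {H : Type*} [RCLike 𝕜] [NormedAddCommGroup H]
    [InnerProductSpace 𝕜 H] [NormedSpace ℝ H] {f : ℝ → H} {f' : H} {s : Set ℝ} {t : ℝ}
    (hf : HasDerivWithinAt f f' s t) :
    HasDerivWithinAt (fun τ => ‖f τ‖ ^ 2) (2 * RCLike.re (inner 𝕜 (f t) f')) s t := by
  have h := (RCLike.reCLM (K := 𝕜)).hasFDerivAt.comp_hasDerivWithinAt t (hf.inner 𝕜 hf)
  convert! h using 1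
  · ext τ
    exact (inner_self_eq_norm_sq (𝕜 := 𝕜) (f τ)).symm
  · rw [RCLike.reCLM_apply, map_add, inner_re_symm f' (f t), two_mul]

theorem hasDerivWithinAt_oscillator_energy [IsScalarTower ℝ 𝕜 H] {z p h : ℝ → H} {c : ℝ}
    {s : Set ℝ} {t : ℝ} (hz : HasDerivWithinAt z (p t) s t)
    (hp : HasDerivWithinAt p (h t - c ^ 2 • z t) s t) :
    HasDerivWithinAt (fun τ => ‖p τ‖ ^ 2 + c ^ 2 * ‖z τ‖ ^ 2)
      (2 * RCLike.re (inner 𝕜 (p t) (h t))) s t := by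
  convert! (hasDerivWithinAt_norm_sq 𝕜 hp).add
    ((hasDerivWithinAt_norm_sq 𝕜 hz).const_mul (c ^ 2)) using 1
  rw [inner_sub_right, inner_smul_right_eq_smul, map_sub, RCLike.smul_re, inner_re_symm (z t) (p t)]
  ring

namespace IsResolutionOfIdentity

variable {P : ι → H →L[𝕜] H} (hP : IsResolutionOfIdentity P) {c : ι → ℝ}
include hP

omit [NormedSpace ℝ H] in
theorem sum_two_mul_re_inner_le (S : Finset ι) (x y : H) :
    ∑ i ∈ S, 2 * RCLike.re (inner 𝕜 (P i x) (P i y)) ≤ ‖x‖ ^ 2 + ‖y‖ ^ 2 := by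
  have hterm (i : ι) : 2 * RCLike.re (inner 𝕜 (P i x) (P i y)) ≤ ‖P i x‖ ^ 2 + ‖P i y‖ ^ 2 := by
    have := re_inner_le_norm (𝕜 := 𝕜) (P i x) (P i y)
    linarith [two_mul_le_add_sq ‖P i x‖ ‖P i y‖]
  exact (Finset.sum_le_sum fun i _ => hterm i).trans
    (sum_le_hasSum S (fun i _ => by positivity) ((hP.hasSum_norm_sq x).add (hP.hasSum_norm_sq y)))

theorem hasSum_energy {x y z : H} (h : HasSum (fun i => c i • P i x) z) :
    HasSum (fun i => ‖P i y‖ ^ 2 + c i ^ 2 * ‖P i x‖ ^ 2) (‖y‖ ^ 2 + ‖z‖ ^ 2) :=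
  (hP.hasSum_norm_sq y).add (hP.hasSum_norm_sq_of_hasSum h)

variable [IsScalarTower ℝ 𝕜 H] {T : ℝ} {w v g A : ℝ → H}
  (hw : ∀ t ∈ Icc 0 T, HasDerivWithinAt w (v t) (Icc 0 T) t)
  (hv : ContinuousOn v (Icc 0 T)) (hg : ContinuousOn g (Icc 0 T))
  (hmode : ∀ i, ∀ t ∈ Icc 0 T, HasDerivWithinAt (fun τ => P i (v τ))
    (P i (g t) - c i ^ 2 • P i (w t)) (Icc 0 T) t)
  (hA : ∀ t ∈ Icc 0 T, HasSum (fun i => c i • P i (w t)) (A t))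
include hw hv hg hmode hA

theorem energy_le {t : ℝ} (ht : t ∈ Icc 0 T) :
    ‖v t‖ ^ 2 + ‖A t‖ ^ 2
      ≤ ‖v 0‖ ^ 2 + ‖A 0‖ ^ 2 + ∫ τ in (0 : ℝ)..t, (‖v τ‖ ^ 2 + ‖g τ‖ ^ 2) := by
  have hsub : Icc 0 t ⊆ Icc 0 T := Icc_subset_Icc_right ht.2
  refine hasSum_le_of_sum_le (hP.hasSum_energy (hA t ht)) fun S => ?_
  have hderiv (r : ℝ) (hr : r ∈ Icc 0 T) : HasDerivWithinAt
      (fun τ => ∑ i ∈ S, (‖P i (v τ)‖ ^ 2 + c i ^ 2 * ‖P i (w τ)‖ ^ 2))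
      (∑ i ∈ S, 2 * RCLike.re (inner 𝕜 (P i (v r)) (P i (g r)))) (Icc 0 T) r :=
    HasDerivWithinAt.fun_sum fun i _ => hasDerivWithinAt_oscillator_energy (h := fun τ => P i (g τ))
      (((P i).restrictScalars ℝ).hasFDerivAt.comp_hasDerivWithinAt r (hw r hr)) (hmode i r hr)
  have hint : ContinuousOn (fun τ => ‖v τ‖ ^ 2 + ‖g τ‖ ^ 2) (Icc 0 t) :=
    ((hv.norm.pow 2).add (hg.norm.pow 2)).mono hsub
  have hftc := intervalIntegral.sub_le_integral_of_hasDeriv_right_of_le ht.1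
    (fun r hr => (hderiv r (hsub hr)).continuousWithinAt.mono hsub)
    (fun r hr => (hderiv r (hsub (Ioo_subset_Icc_self hr))).mono_of_mem_nhdsWithin
      (Icc_mem_nhdsGT_of_mem ⟨hr.1.le, hr.2.trans_le ht.2⟩))
    hint.integrableOn_Icc
    fun r _ => hP.sum_two_mul_re_inner_le S (v r) (g r)
  have hzero := sum_le_hasSum S (fun i _ => by positivity)
    (hP.hasSum_energy (y := v 0) (hA 0 ⟨le_rfl, ht.1.trans ht.2⟩))
  linarith

theorem energy_le_gronwallBound {K d : ℝ} (hK : 0 ≤ K)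
    (hAc : ContinuousOn A (Icc 0 T))
    (hgle : ∀ t ∈ Icc 0 T, ‖g t‖ ^ 2 ≤ K * (‖v t‖ ^ 2 + ‖A t‖ ^ 2) + d)
    {t : ℝ} (ht : t ∈ Icc 0 T) :
    ‖v t‖ ^ 2 + ‖A t‖ ^ 2 ≤ gronwallBound (‖v 0‖ ^ 2 + ‖A 0‖ ^ 2) (1 + K) d t := by
  have hE : ContinuousOn (fun τ => ‖v τ‖ ^ 2 + ‖A τ‖ ^ 2) (Icc 0 T) := by fun_prop
  refine le_gronwallBound_of_le_integral (by positivity) hE (fun r hr => ?_) ht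
  refine (hP.energy_le hw hv hg hmode hA hr).trans ?_
  have hsub : Icc 0 r ⊆ Icc 0 T := Icc_subset_Icc_right hr.2
  gcongr
  refine intervalIntegral.integral_mono_on hr.1 ?_ ?_ fun τ hτ => ?_
  · exact (((hv.norm.pow 2).add (hg.norm.pow 2)).mono hsub).intervalIntegrable_of_Icc hr.1
  · exact (((hE.const_mul _).add_const _).mono hsub).intervalIntegrable_of_Icc hr.1
  · linarith [hgle τ (hsub hτ), sq_nonneg ‖A τ‖]

end IsResolutionOfIdentity

end Energy

section Stability

variable {q : LInf} {s T : ℝ}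

theorem tendsto_gronwallBound_zero {ι : Type*} {l : Filter ι} {δ ε : ι → ℝ} {K x : ℝ}
    (hδ : Tendsto δ l (𝓝 0)) (hε : Tendsto ε l (𝓝 0)) :
    Tendsto (fun i => gronwallBound (δ i) K (ε i) x) l (𝓝 0) := by
  rcases eq_or_ne K 0 with rfl | hK
  · simpa [gronwallBound_K0] using hδ.add (hε.mul_const x)
  · simpa [gronwallBound_of_K_ne_0 hK] using
      (hδ.mul_const (Real.exp (K * x))).add ((hε.div_const K).mul_const (Real.exp (K * x) - 1))

theorem MemDomPow.hasSum {r : ℝ} {f : L2} (hf : MemDomPow q r f) :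
    HasSum (fun lam : ℝ => lam ^ r • spectralProj q lam f) (fracPow q r f) :=
  Summable.hasSum hf

theorem MemDomPow.hasSum_sub {r : ℝ} {f g : L2} (hf : MemDomPow q r f)
    (hg : MemDomPow q r g) :
    HasSum (fun lam : ℝ => lam ^ r • spectralProj q lam (f - g))
      (fracPow q r f - fracPow q r g) := by
  simpa only [map_sub, smul_sub] using hf.hasSum.sub hg.hasSum

theorem MemDomPow.sub {r : ℝ} {f g : L2} (hf : MemDomPow q r f) (hg : MemDomPow q r g) :
    MemDomPow q r (f - g) :=
  (hf.hasSum_sub hg).summable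

theorem MemDomPow.fracPow_sub {r : ℝ} {f g : L2} (hf : MemDomPow q r f) (hg : MemDomPow q r g) :
    fracPow q r (f - g) = fracPow q r f - fracPow q r g :=
  (hf.hasSum_sub hg).tsum_eq

theorem exists_pos_forall_norm_le_mul_normW (hq : ∀ lam, IsEigenvalue q lam → 0 < lam)
    (hs : 0 ≤ s) : ∃ C > 0, ∀ f : L2, MemW q s f → ‖f‖ ≤ C * normW q s f := by
  obtain ⟨m, hm, hle⟩ := exists_pos_forall_isEigenvalue_le hq
  have hP := isResolutionOfIdentity_spectralProj fun h0 => (hq 0 h0).false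
  have hpos : 0 < m ^ (s / 2) := Real.rpow_pos_of_pos hm _
  refine ⟨(m ^ (s / 2))⁻¹, inv_pos.2 hpos, fun f hf => (le_inv_mul_iff₀ hpos).2 ?_⟩
  refine hP.mul_norm_le_of_hasSum hpos.le (fun lam hlam => ?_) (MemDomPow.hasSum hf)
  have hmlam : m ≤ lam := hle lam (isEigenvalue_of_spectralProj_ne_zero hlam)
  gcongr

theorem smul_sub_smul_eq (a a' : LInf) (f f' : L2) :
    (a' • f' - a • f : L2) = (a' • (f' - f) : L2) + ((a' - a) • f : L2) := by
  rw [sub_eq_add_neg f' f, Lp.add_smul, Lp.smul_neg, sub_eq_add_neg a' a, Lp.smul_add, Lp.neg_smul]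
  abel

theorem norm_smul_sub_smul_le (a a' : LInf) (f f' : L2) :
    ‖(a' • f' - a • f : L2)‖ ≤ ‖a'‖ * ‖f' - f‖ + ‖a' - a‖ * ‖f‖ := by
  rw [smul_sub_smul_eq]
  exact norm_add_le_of_le (Lp.norm_smul_le _ _) (Lp.norm_smul_le _ _)

/-- The lower order terms `a u + b ∂ₜu` of the wave equation, as a function of time. -/
def lowerOrder (T : ℝ) (a b : LInf) (u : ℝ → L2) (t : ℝ) : L2 :=
  a • u t + b • dt T u t

theorem norm_lowerOrder_sub_sq_le {a b a' b' : LInf} {u u' : ℝ → L2} {t M K C N : ℝ}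
    (ht : ‖u t‖ ≤ M) (hdt : ‖dt T u t‖ ≤ M) (hN : ‖u' t - u t‖ ≤ C * N)
    (ha : ‖a'‖ * C ≤ K) (hb : ‖b'‖ ≤ K) (hN0 : 0 ≤ N) :
    ‖lowerOrder T a' b' u' t - lowerOrder T a b u t‖ ^ 2
      ≤ 3 * K ^ 2 * (‖dt T u' t - dt T u t‖ ^ 2 + N ^ 2)
        + 3 * ((‖a' - a‖ + ‖b' - b‖) * M) ^ 2 := by
  have hle : ‖lowerOrder T a' b' u' t - lowerOrder T a b u t‖
      ≤ K * N + K * ‖dt T u' t - dt T u t‖ + (‖a' - a‖ + ‖b' - b‖) * M :=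
    calc ‖lowerOrder T a' b' u' t - lowerOrder T a b u t‖
      _ ≤ ‖a'‖ * ‖u' t - u t‖ + ‖a' - a‖ * ‖u t‖
          + (‖b'‖ * ‖dt T u' t - dt T u t‖ + ‖b' - b‖ * ‖dt T u t‖) := by
        rw [lowerOrder, lowerOrder, add_sub_add_comm]
        exact norm_add_le_of_le (norm_smul_sub_smul_le _ _ _ _) (norm_smul_sub_smul_le _ _ _ _)
      _ ≤ ‖a'‖ * (C * N) + ‖a' - a‖ * M + (K * ‖dt T u' t - dt T u t‖ + ‖b' - b‖ * M) := by
        gcongr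
      _ ≤ K * N + ‖a' - a‖ * M + (K * ‖dt T u' t - dt T u t‖ + ‖b' - b‖ * M) := by
        rw [← mul_assoc]
        gcongr
      _ = _ := by ring
  have hsq (x y z : ℝ) : (x + y + z) ^ 2 ≤ 3 * (x ^ 2 + y ^ 2 + z ^ 2) := by
    nlinarith [sq_nonneg (x - y), sq_nonneg (y - z), sq_nonneg (z - x)]
  calc ‖lowerOrder T a' b' u' t - lowerOrder T a b u t‖ ^ 2
    _ ≤ (K * N + K * ‖dt T u' t - dt T u t‖ + (‖a' - a‖ + ‖b' - b‖) * M) ^ 2 := by gcongr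
    _ ≤ 3 * ((K * N) ^ 2 + (K * ‖dt T u' t - dt T u t‖) ^ 2
          + ((‖a' - a‖ + ‖b' - b‖) * M) ^ 2) := hsq _ _ _
    _ = _ := by ring

namespace IsSolution

variable {a b : LInf} {u₀ u₁ : L2} {u : ℝ → L2} (hu : IsSolution q s T a b u₀ u₁ u)
include hu

theorem hasDerivWithinAt {t : ℝ} (ht : t ∈ Icc 0 T) :
    HasDerivWithinAt u (dt T u t) (Icc 0 T) t :=
  (hu.contDiffOn.differentiableOn one_ne_zero t ht).hasDerivWithinAt

theorem continuousOn_dt (hT : 0 < T) : ContinuousOn (dt T u) (Icc 0 T) :=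
  hu.contDiffOn.continuousOn_derivWithin (uniqueDiffOn_Icc hT) le_rfl

theorem continuousOn_fracPow : ContinuousOn (fun t => fracPow q (s / 2) (u t)) (Icc 0 T) := by
  intro t ht
  refine tendsto_iff_norm_sub_tendsto_zero.2 ((hu.continuousOn_W t ht).congr' ?_)
  filter_upwards [self_mem_nhdsWithin] with τ hτ
  rw [normW, (hu.memW τ hτ).fracPow_sub (hu.memW t ht)]

theorem continuousOn_lowerOrder (hT : 0 < T) : ContinuousOn (lowerOrder T a b u) (Icc 0 T) :=
  ((mulOp a).continuous.comp_continuousOn hu.contDiffOn.continuousOn).add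
    ((mulOp b).continuous.comp_continuousOn (hu.continuousOn_dt hT))

theorem hasDerivWithinAt_inner_spectralProj (hP : IsResolutionOfIdentity (spectralProj q))
    (lam : ℝ) (x : L2) {t : ℝ} (ht : t ∈ Icc 0 T) :
    HasDerivWithinAt (fun τ => inner ℂ x (spectralProj q lam (dt T u τ)))
      (inner ℂ x (spectralProj q lam (-lowerOrder T a b u t)
        - (lam ^ (s / 2)) ^ 2 • spectralProj q lam (u t))) (Icc 0 T) t := by
  have hsum := hP.hasSum_smul_apply_apply (c := fun lam => lam ^ (s / 2)) lam x
  have hfrac : fracPow q (s / 2) (spectralProj q lam x) = lam ^ (s / 2) • spectralProj q lam x :=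
    hsum.tsum_eq
  have hu' : spectralProj q lam (fracPow q (s / 2) (u t))
      = lam ^ (s / 2) • spectralProj q lam (u t) :=
    hP.apply_of_hasSum (MemDomPow.hasSum (hu.memW t ht)) lam
  have hsymm (y z : L2) : inner ℂ (spectralProj q lam y) z = inner ℂ y (spectralProj q lam z) :=
    hP.isSymmetric lam y z
  convert! hu.equation (spectralProj q lam x) hsum.summable t ht using 1
  · simp only [hsymm]
  · rw [hfrac, inner_smul_left_eq_smul, hsymm, hu', inner_smul_right_eq_smul, hsymm, hsymm,
      lowerOrder, inner_sub_right, inner_smul_right_eq_smul, map_neg, map_add, inner_neg_right,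
      inner_add_right, smul_smul, sq]
    abel

theorem hasDerivWithinAt_spectralProj_dt (hT : 0 < T)
    (hP : IsResolutionOfIdentity (spectralProj q)) (lam : ℝ) {t : ℝ} (ht : t ∈ Icc 0 T) :
    HasDerivWithinAt (fun τ => spectralProj q lam (dt T u τ))
      (spectralProj q lam (-lowerOrder T a b u t)
        - (lam ^ (s / 2)) ^ 2 • spectralProj q lam (u t)) (Icc 0 T) t := by
  have hlower := hu.continuousOn_lowerOrder hT
  have huc := hu.contDiffOn.continuousOn
  exact hasDerivWithinAt_of_inner (𝕜 := ℂ) (by fun_prop)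
    (fun x τ hτ => hu.hasDerivWithinAt_inner_spectralProj hP lam x hτ) ht

theorem energy_sub_le_gronwallBound (hT : 0 < T) (hP : IsResolutionOfIdentity (spectralProj q))
    {a' b' : LInf} {u₀' u₁' : L2} {u' : ℝ → L2} (hu' : IsSolution q s T a' b' u₀' u₁' u')
    {C K M : ℝ} (hC : ∀ f : L2, MemW q s f → ‖f‖ ≤ C * normW q s f)
    (hM : ∀ t ∈ Icc 0 T, ‖u t‖ ≤ M) (hMdt : ∀ t ∈ Icc 0 T, ‖dt T u t‖ ≤ M)
    (ha : ‖a'‖ * C ≤ K) (hb : ‖b'‖ ≤ K) {t : ℝ} (ht : t ∈ Icc 0 T) :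
    ‖dt T u' t - dt T u t‖ ^ 2 + normW q s (u' t - u t) ^ 2
      ≤ gronwallBound (‖u₁' - u₁‖ ^ 2 + normW q s (u₀' - u₀) ^ 2) (1 + 3 * K ^ 2)
        (3 * ((‖a' - a‖ + ‖b' - b‖) * M) ^ 2) t := by
  have hsub (τ : ℝ) (hτ : τ ∈ Icc 0 T) := (hu'.memW τ hτ).fracPow_sub (hu.memW τ hτ)
  have h := hP.energy_le_gronwallBound (c := fun lam => lam ^ (s / 2))
    (w := fun τ => u' τ - u τ) (v := fun τ => dt T u' τ - dt T u τ)
    (g := fun τ => -(lowerOrder T a' b' u' τ - lowerOrder T a b u τ))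
    (A := fun τ => fracPow q (s / 2) (u' τ) - fracPow q (s / 2) (u τ))
    (K := 3 * K ^ 2) (d := 3 * ((‖a' - a‖ + ‖b' - b‖) * M) ^ 2)
    (fun τ hτ => (hu'.hasDerivWithinAt hτ).sub (hu.hasDerivWithinAt hτ))
    ((hu'.continuousOn_dt hT).sub (hu.continuousOn_dt hT))
    ((hu'.continuousOn_lowerOrder hT).sub (hu.continuousOn_lowerOrder hT)).neg
    (fun lam τ hτ => ?_)
    (fun τ hτ => (hu'.memW τ hτ).hasSum_sub (hu.memW τ hτ))
    (by positivity) (hu'.continuousOn_fracPow.sub hu.continuousOn_fracPow)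
    (fun τ hτ => ?_) ht
  · simpa only [normW, hsub t ht, hsub 0 ⟨le_rfl, hT.le⟩, ← hu.initial, ← hu'.initial,
      ← hu.initial_dt, ← hu'.initial_dt] using h
  · convert! (hu'.hasDerivWithinAt_spectralProj_dt hT hP lam hτ).sub
      (hu.hasDerivWithinAt_spectralProj_dt hT hP lam hτ) using 1
    · ext τ
      simp
    · simp only [map_neg, map_sub, smul_sub]
      abel
  · rw [norm_neg, ← hsub τ hτ]
    exact norm_lowerOrder_sub_sq_le (hM τ hτ) (hMdt τ hτ)
      (hC _ ((hu'.memW τ hτ).sub (hu.memW τ hτ))) ha hb (norm_nonneg _)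

theorem exists_tendsto_zero_forall_energy_sub_le (hT : 0 < T)
    (hq : ∀ lam, IsEigenvalue q lam → 0 < lam) (hs : 0 ≤ s) {ι : Type*} {l : Filter ι}
    {a' b' : ι → LInf} {u₀' u₁' : ι → L2} {u' : ι → ℝ → L2}
    (hu' : ∀ᶠ i in l, IsSolution q s T (a' i) (b' i) (u₀' i) (u₁' i) (u' i))
    (ha : Tendsto a' l (𝓝 a)) (hb : Tendsto b' l (𝓝 b))
    (hu₀ : Tendsto (fun i => normW q s (u₀' i - u₀)) l (𝓝 0)) (hu₁ : Tendsto u₁' l (𝓝 u₁)) :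
    ∃ B : ι → ℝ, Tendsto B l (𝓝 0) ∧ ∀ᶠ i in l, ∀ t ∈ Icc 0 T,
      ‖dt T (u' i) t - dt T u t‖ ^ 2 + normW q s (u' i t - u t) ^ 2 ≤ B i := by
  have hP := isResolutionOfIdentity_spectralProj fun h => (hq 0 h).false
  obtain ⟨C, -, hC⟩ := exists_pos_forall_norm_le_mul_normW hq hs
  obtain ⟨M₁, hM₁⟩ := isCompact_Icc.exists_bound_of_continuousOn hu.contDiffOn.continuousOn
  obtain ⟨M₂, hM₂⟩ := isCompact_Icc.exists_bound_of_continuousOn (hu.continuousOn_dt hT)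
  let K := max (‖a‖ * C + 1) (‖b‖ + 1)
  have haK : ∀ᶠ i in l, ‖a' i‖ * C ≤ K :=
    ((ha.norm.mul_const C).eventually_le_const (lt_add_one _)).mono
      fun i hi => hi.trans (le_max_left _ _)
  have hbK : ∀ᶠ i in l, ‖b' i‖ ≤ K :=
    (hb.norm.eventually_le_const (lt_add_one _)).mono fun i hi => hi.trans (le_max_right _ _)
  refine ⟨fun i => gronwallBound (‖u₁' i - u₁‖ ^ 2 + normW q s (u₀' i - u₀) ^ 2) (1 + 3 * K ^ 2)
    (3 * ((‖a' i - a‖ + ‖b' i - b‖) * max M₁ M₂) ^ 2) T, tendsto_gronwallBound_zero ?_ ?_, ?_⟩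
  · simpa using ((tendsto_iff_norm_sub_tendsto_zero.1 hu₁).pow 2).add (hu₀.pow 2)
  · simpa using ((((tendsto_iff_norm_sub_tendsto_zero.1 ha).add
      (tendsto_iff_norm_sub_tendsto_zero.1 hb)).mul_const (max M₁ M₂)).pow 2).const_mul 3
  · filter_upwards [hu', haK, hbK] with i hi hai hbi t ht
    refine (hu.energy_sub_le_gronwallBound hT hP hi hC
      (fun τ hτ => (hM₁ τ hτ).trans (le_max_left _ _))
      (fun τ hτ => (hM₂ τ hτ).trans (le_max_right _ _)) hai hbi ht).trans ?_
    exact gronwallBound_mono (by positivity) (by positivity) (by positivity) ht.2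

end IsSolution

end Stability

end SturmLiouville

end

open SturmLiouville in
theorem mainTheorem9_general {ι : Type*} {l : Filter ι} {T s : ℝ} (hT : 0 < T) (hs : 0 ≤ s)
    {q : LInf} (hq : ∀ lam, IsEigenvalue q lam → 0 < lam) {a b : LInf} {u₀ u₁ : L2} {u : ℝ → L2}
    (hu : IsSolution q s T a b u₀ u₁ u) {a' b' : ι → LInf} {u₀' u₁' : ι → L2} {u' : ι → ℝ → L2}
    (hu' : ∀ᶠ i in l, IsSolution q s T (a' i) (b' i) (u₀' i) (u₁' i) (u' i))
    (ha : Tendsto a' l (𝓝 a)) (hb : Tendsto b' l (𝓝 b))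
    (hu₀ : Tendsto (fun i => normW q s (u₀' i - u₀)) l (𝓝 0)) (hu₁ : Tendsto u₁' l (𝓝 u₁)) :
    TendstoUniformlyOn u' u l (Icc 0 T) ∧
      TendstoUniformlyOn (fun i => dt T (u' i)) (dt T u) l (Icc 0 T) ∧
      TendstoUniformlyOn (fun i t => normW q s (u' i t - u t)) 0 l (Icc 0 T) := by
  obtain ⟨C, hC0, hC⟩ := exists_pos_forall_norm_le_mul_normW hq hs
  obtain ⟨B, hB, hle⟩ :=
    hu.exists_tendsto_zero_forall_energy_sub_le hT hq hs hu' ha hb hu₀ hu₁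
  have hsmall (η : ℝ) (hη : 0 < η) : ∀ᶠ i in l, ∀ t ∈ Icc 0 T,
      ‖dt T (u' i) t - dt T u t‖ < η ∧ normW q s (u' i t - u t) < η := by
    filter_upwards [hle, hB.eventually_lt_const (pow_pos hη 2)] with i hi hBi t ht
    have hlt := (hi t ht).trans_lt hBi
    exact ⟨lt_of_pow_lt_pow_left₀ 2 hη.le ((le_add_of_nonneg_right (sq_nonneg _)).trans_lt hlt),
      lt_of_pow_lt_pow_left₀ 2 hη.le ((le_add_of_nonneg_left (sq_nonneg _)).trans_lt hlt)⟩
  simp only [Metric.tendstoUniformlyOn_iff, dist_comm _ (u' _ _), dist_comm _ (dt T (u' _) _),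
    dist_eq_norm]
  refine ⟨fun η hη => ?_, fun η hη => (hsmall η hη).mono fun i hi t ht => (hi t ht).1,
    fun η hη => (hsmall η hη).mono fun i hi t ht => ?_⟩
  · filter_upwards [hu', hsmall (C⁻¹ * η) (by positivity)] with i hi hlt t ht
    exact (hC _ (MemDomPow.sub (hi.memW t ht) (hu.memW t ht))).trans_lt
      ((lt_inv_mul_iff₀ hC0).1 (hlt t ht).2)
  · simpa [normW] using (hi t ht).2

theorem mainTheorem9 (T s : ℝ) (hT : 0 < T) (hs : 0 ≤ s)
    (q : SturmLiouville.LInf)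
    (hq : ∀ lam : ℝ, SturmLiouville.IsEigenvalue q lam → 0 < lam)
    (a b : SturmLiouville.LInf) (ha : 0 ≤ a) (hb : 0 ≤ b)
    (u₀ u₁ : SturmLiouville.L2) (hu₀ : SturmLiouville.MemW q s u₀)
    (u : ℝ → SturmLiouville.L2) (hu : SturmLiouville.IsSolution q s T a b u₀ u₁ u)
    (aε bε : ℝ → SturmLiouville.LInf) (u₀ε u₁ε : ℝ → SturmLiouville.L2)
    (ha_lim : Tendsto (fun ε => ‖aε ε - a‖) (𝓝[>] 0) (𝓝 0))
    (hb_lim : Tendsto (fun ε => ‖bε ε - b‖) (𝓝[>] 0) (𝓝 0))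
    (hu₀_lim : Tendsto (fun ε => SturmLiouville.normW q s (u₀ε ε - u₀)) (𝓝[>] 0) (𝓝 0))
    (hu₁_lim : Tendsto (fun ε => ‖u₁ε ε - u₁‖) (𝓝[>] 0) (𝓝 0))
    (uε : ℝ → ℝ → SturmLiouville.L2)
    (huε : SturmLiouville.IsVeryWeakSolution q s T aε bε u₀ε u₁ε uε) :
    TendstoUniformlyOn uε u (𝓝[>] 0) (Icc 0 T) :=
  (mainTheorem9_general hT hs hq hu (mem_of_superset (Ioc_mem_nhdsGT one_pos) huε.isSolution)
    (tendsto_iff_norm_sub_tendsto_zero.2 ha_lim) (tendsto_iff_norm_sub_tendsto_zero.2 hb_lim)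
    hu₀_lim (tendsto_iff_norm_sub_tendsto_zero.2 hu₁_lim)).1
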